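/- Conventions. An mm-space is a complete separable metric space with a Borel probability measure. A parametrization of an mm-space $(X,\mu,g)$ is a Borel map $\varphi:[0,1)\to X$ with $\varphi_\#\lambda=\mu$, where $\lambda$ is Lebesgue measure. For measurable $f,h:[0,1)\to\mathbb R$ let $me_\lambda(f,h)=\inf\{\epsilon>0:\lambda(|f-h|>\epsilon)\le\epsilon\}$, and let $$d_{conc}(X,Y)=\inf_{\varphi,\psi}\,(me_\lambda)_H\bigl(Lip_1(X)\circ\varphi,\ Lip_1(Y)\circ\psi\bigr),$$ where $\varphi,\psi$ run over all parametrizations of $X$ and $Y$, $Lip_1$ is the set of all real-valued $1$-Lipschitz functions, and $(me_\lambda)_H$ is the Hausdorff distance with respect to $me_\lambda$. A sequence of mm-spaces $X_n$ concentrates to an mm-space $X$ if $d_{conc}(X_n,X)\to 0$. Statement. For each $n$ let $N_n$ be a connected complete separable smooth Riemannian manifold with geodesic distance $g_n$, and let $\mu_n$ be a Borel probability measure on $N_n$ that is positive on nonempty open sets. Let $M_n\subsetneq N_n$ be a connected embedded Riemannian submanifold, closed as a subset, which is totally geodesic and whose own geodesic distance $g'_n$ satisfies $g'_n(x,y)=g_n(x,y)$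 for all $x,y\in M_n$. Suppose that $(M_n)$ is a concentration locus for $(N_n)$ with radii $\varepsilon_n$, that is, $\varepsilon_n>0$, $\varepsilon_n\to 0$ and $$\mu_n\bigl(N_n\setminus\{x: g_n(x,M_n)<\varepsilon_n\}\bigr)\to 0 .$$ Let $proj_n:N_n\to M_n$ be a Borel map with $g_n(x,proj_n(x))=g_n(x,M_n)$ for all $x\in N_n$, and let $\sigma_n=(proj_n)_\#\mu_n$. If $(M_n,\sigma_n,g'_n)$ concentrates to an mm-space $(M,\sigma,g')$, then $(N_n,\mu_n,g_n)$ concentrates to the same mm-space $(M,\sigma,g')$. -/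

import Mathlib

open MeasureTheory Set Filter
open scoped Topology Manifold ContDiff Bundle

noncomputable section

/-- The half-open unit interval `I = [0, 1)`. -/
abbrev UnitIco : Type := Set.Ico (0 : ℝ) 1

/-- Lebesgue measure on `I = [0, 1)`. -/
def lebUnit : Measure UnitIco := Measure.comap Subtype.val volume

/-- The Ky Fan pseudo-metric
`me_ν(f, g) = inf {ε > 0 | ν {x | |f x - g x| > ε} ≤ ε}` on real functions. -/
def meDist {Ω : Type*} [MeasurableSpace Ω] (ν : Measure Ω) (f g : Ω → ℝ) : ℝ :=
  sInf {ε : ℝ | 0 < ε ∧ ν {x | ε < |f x - g x|} ≤ ENNReal.ofReal ε}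

/-- The Hausdorff distance of two sets `A`, `B` with respect to a distance function `d`:
the infimum of all `ε > 0` such that each of the two sets lies in the open
`ε`-neighbourhood of the other. -/
def hausdorffDistOf {α : Type*} (d : α → α → ℝ) (A B : Set α) : ℝ :=
  sInf {ε : ℝ | 0 < ε ∧ (∀ b ∈ B, ∃ a ∈ A, d a b < ε) ∧ (∀ a ∈ A, ∃ b ∈ B, d b a < ε)}

/-- A parametrization of `(X, μ)`: a Borel map `φ : [0, 1) → X` that pushes Lebesgue measure
forward to `μ`. -/
structure IsParametrization {X : Type*} [MeasurableSpace X] (μ : Measure X)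
    (φ : UnitIco → X) : Prop where
  measurable : Measurable φ
  map_eq : Measure.map φ lebUnit = μ

/-- `Lip₁(X) ∘ φ`, the set of all compositions of `1`-Lipschitz functions on `X` with `φ`. -/
def lipOneComp {X : Type*} [MetricSpace X] (φ : UnitIco → X) : Set (UnitIco → ℝ) :=
  {h | ∃ f : X → ℝ, LipschitzWith 1 f ∧ h = f ∘ φ}

/-- The observable distance `d_conc` of the mm-spaces `(X, μ)` and `(Y, ν)`. -/
def dConc {X : Type*} [MetricSpace X] [MeasurableSpace X] (μ : Measure X)
    {Y : Type*} [MetricSpace Y] [MeasurableSpace Y] (ν : Measure Y) : ℝ :=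
  sInf {r : ℝ | ∃ (φ : UnitIco → X) (ψ : UnitIco → Y),
    IsParametrization μ φ ∧ IsParametrization ν ψ ∧
      r = hausdorffDistOf (meDist lebUnit) (lipOneComp φ) (lipOneComp ψ)}

/-- The mm-spaces `(X n, μ n)` concentrate to the mm-space `(Y, ν)`. -/
def ConcentratesTo {X : ℕ → Type*} [∀ n, MetricSpace (X n)] [∀ n, MeasurableSpace (X n)]
    (μ : ∀ n, Measure (X n)) {Y : Type*} [MetricSpace Y] [MeasurableSpace Y]
    (ν : Measure Y) : Prop :=
  Tendsto (fun n => dConc (μ n) ν) atTop (𝓝 0)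

/-- The proper closed subsets `S n` of the metric spaces `X n`, with normalized and
fully supported measures `μ n`, form a concentration locus with radii `ε n → 0`:
the measure of the complement of the `ε n`-neighbourhood of `S n` tends to `0`. -/
structure IsConcentrationLocus {X : ℕ → Type*} [∀ n, MetricSpace (X n)]
    [∀ n, MeasurableSpace (X n)] (μ : ∀ n, Measure (X n)) (S : ∀ n, Set (X n))
    (ε : ℕ → ℝ) : Prop where
  measure_univ : ∀ n, μ n univ = 1
  measure_open_pos : ∀ n, ∀ U : Set (X n), IsOpen U → U.Nonempty → 0 < μ n U
  isClosed : ∀ n, IsClosed (S n)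
  proper : ∀ n, S n ≠ univ
  radius_pos : ∀ n, 0 < ε n
  radius_tendsto : Tendsto ε atTop (𝓝 0)
  tendsto_compl : Tendsto (fun n => μ n (Metric.thickening (ε n) (S n))ᶜ) atTop (𝓝 0)

/-- `γ` restricted to `[a, b]` is a geodesic, i.e. a curve of constant speed `c` which locally
realizes the distance. -/
def IsGeodesicOn {X : Type*} [MetricSpace X] (γ : ℝ → X) (a b : ℝ) : Prop :=
  ∃ c : ℝ, 0 ≤ c ∧ ∀ t ∈ Icc a b, ∃ δ > 0, ∀ s ∈ Icc a b, ∀ s' ∈ Icc a b,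
    |s - t| < δ → |s' - t| < δ → dist (γ s) (γ s') = c * |s - s'|

/-- `ι` is totally geodesic: it maps every geodesic of `M` to a geodesic of `N`. -/
def IsTotallyGeodesic {M N : Type*} [MetricSpace M] [MetricSpace N] (ι : M → N) : Prop :=
  ∀ (γ : ℝ → M) (a b : ℝ), a < b → IsGeodesicOn γ a b → IsGeodesicOn (ι ∘ γ) a b

/-- `ι` is the inclusion of an embedded Riemannian submanifold: it is a smooth embedding, and the
Riemannian metric of the submanifold is the one induced by the ambient Riemannian metric. -/
structure IsRiemannianEmbedding {p q : ℕ}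
    {M : Type*} [MetricSpace M] [ChartedSpace (EuclideanSpace ℝ (Fin p)) M]
    [Bundle.RiemannianBundle (fun x : M => TangentSpace (𝓡 p) x)]
    {N : Type*} [MetricSpace N] [ChartedSpace (EuclideanSpace ℝ (Fin q)) N]
    [Bundle.RiemannianBundle (fun x : N => TangentSpace (𝓡 q) x)]
    (ι : M → N) : Prop where
  isSmoothEmbedding : Manifold.IsSmoothEmbedding (𝓡 p) (𝓡 q) ∞ ι
  inner_eq : ∀ (x : M) (v w : TangentSpace (𝓡 p) x),
    inner ℝ (mfderiv (𝓡 p) (𝓡 q) ι x v) (mfderiv (𝓡 p) (𝓡 q) ι x w) = inner ℝ v w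

/-- `proj` is a projection map onto the submanifold with inclusion `ι`: a Borel map that sends each
point of the ambient space to a point of the submanifold at minimal distance. -/
structure IsProjection {M N : Type*} [MetricSpace M] [MeasurableSpace M]
    [MetricSpace N] [MeasurableSpace N] (ι : M → N) (proj : N → M) : Prop where
  measurable : Measurable proj
  dist_eq : ∀ x, dist x (ι (proj x)) = Metric.infDist x (range ι)

end

/-!
The argument is metric and measure theoretic; the manifold structure enters only through
the fact that the inclusion `ι : M → N` is an isometry of metric spaces.

Two estimates suffice. First, a `1`-Lipschitz function `f` on `N` differs from `f ∘ ι ∘ proj` by at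
most the distance to the submanifold, so the two are `δ`-close in the Ky Fan metric as soon as the
complement of the `δ`-neighbourhood of the submanifold has measure at most `δ`; and every
`1`-Lipschitz function on `M` is of the form `f ∘ ι`, by McShane's extension theorem. Hence, along
a parametrization `φ` of `N`, the sets `Lip₁(N) ∘ φ` and `Lip₁(M) ∘ (proj ∘ φ)` are `δ`-close.

Second, `d_conc` satisfies the triangle inequality needed to pass from `M` to the limit space.
Given parametrizations `φ'` of `(M, proj_* μ)` and `ψ` of `(X, σ)`, the Ky Fan distances between
`Lip₁(M) ∘ φ'` and `Lip₁(X) ∘ ψ` depend only on the joint law of `(φ', ψ)`. This law is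
disintegrated over `M`, the conditional kernel is pulled back along `proj`, and the resulting
measure on `N × X` is parametrized by the unit interval (`exists_isParametrization_lift`). This
produces parametrizations `φ` of `N` and `ψ'` of `X` such that `(proj ∘ φ, ψ')` has the same joint
law as `(φ', ψ)`. Together these give `d_conc(N, X) ≤ d_conc(M, X) + δ` (`dConc_le_dConc_map_add`).
-/

open ProbabilityTheory

/-! ### Parametrizations by the unit interval -/

instance isProbabilityMeasure_lebUnit : IsProbabilityMeasure lebUnit := by
  refine ⟨?_⟩
  rw [lebUnit, comap_subtype_coe_apply measurableSet_Ico, image_univ, Subtype.range_coe,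
    Real.volume_Ico, sub_zero, ENNReal.ofReal_one]

/-- Every Borel probability measure on a nonempty standard Borel space has a parametrization. -/
theorem exists_isParametrization {X : Type*} [MeasurableSpace X] [StandardBorelSpace X]
    [Nonempty X] (μ : Measure X) [IsProbabilityMeasure μ] :
    ∃ φ : UnitIco → X, IsParametrization μ φ := by
  obtain ⟨f, hf, hfμ⟩ := μ.exists_measurable_map_eq
  -- Mathlib represents `μ` on the closed unit interval, which differs from `[0, 1)` by a null set.
  have hsub : Ico (0 : ℝ) 1 ⊆ Icc 0 1 := Ico_subset_Icc_self
  let incl : UnitIco → unitInterval := Set.inclusion hsub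
  have hmeas : Measurable incl := measurable_inclusion hsub
  have hmap : lebUnit.map incl = (volume : Measure unitInterval) := by
    ext s hs
    rw [Measure.map_apply hmeas hs, lebUnit, comap_subtype_coe_apply measurableSet_Ico,
      unitInterval.volume_apply]
    have himage : Subtype.val '' (incl ⁻¹' s) = Subtype.val '' s \ {1} := by
      ext x
      simp only [mem_image, mem_preimage, Subtype.exists, Set.mem_sdiff, mem_singleton_iff]
      constructor
      · rintro ⟨y, hy, hys, rfl⟩
        exact ⟨⟨y, hsub hy, hys, rfl⟩, hy.2.ne⟩
      · rintro ⟨⟨y, hy, hys, rfl⟩, hne⟩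
        exact ⟨y, ⟨hy.1, lt_of_le_of_ne hy.2 hne⟩, hys, rfl⟩
    rw [himage]
    exact measure_sdiff_null (by simp)
  exact ⟨f ∘ incl, hf.comp hmeas, by
    rw [← Measure.map_map hf hmeas, hmap, hfμ]⟩

/-- Gluing of couplings: parametrizations of a pushforward `proj_* μ` and of `σ` lift to
parametrizations of `μ` and `σ` that induce the same joint law. -/
theorem exists_isParametrization_lift {N M X : Type*} [MeasurableSpace N] [StandardBorelSpace N]
    [MeasurableSpace M] [MeasurableSpace X] [StandardBorelSpace X]
    {μ : Measure N} [IsProbabilityMeasure μ] {σ : Measure X} [IsProbabilityMeasure σ]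
    {proj : N → M} (hproj : Measurable proj) {φ' : UnitIco → M} {ψ : UnitIco → X}
    (hφ' : IsParametrization (μ.map proj) φ') (hψ : IsParametrization σ ψ) :
    ∃ (φ : UnitIco → N) (ψ' : UnitIco → X), IsParametrization μ φ ∧ IsParametrization σ ψ' ∧
      lebUnit.map (fun t => (proj (φ t), ψ' t)) = lebUnit.map (fun t => (φ' t, ψ t)) := by
  have : Nonempty N := nonempty_of_isProbabilityMeasure μ
  have : Nonempty X := nonempty_of_isProbabilityMeasure σ
  have hpair : Measurable (fun t => (φ' t, ψ t)) := hφ'.measurable.prodMk hψ.measurable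
  let ρ : Measure (M × X) := lebUnit.map (fun t => (φ' t, ψ t))
  have : IsProbabilityMeasure ρ := Measure.isProbabilityMeasure_map hpair.aemeasurable
  have hfst : ρ.fst = μ.map proj := by
    rw [Measure.fst_map_prodMk hψ.measurable, hφ'.map_eq]
  have hsnd : ρ.snd = σ := by
    rw [Measure.snd_map_prodMk hφ'.measurable, hψ.map_eq]
  -- `Θ` is the law on `N × X` whose conditional law over `y : N` is that of `ρ` over `proj y`.
  let κ : Kernel N X := ρ.condKernel.comap proj hproj
  let Θ : Measure (N × X) := μ ⊗ₘ κ
  have hprojid : Measurable (Prod.map proj (id : X → X)) := hproj.prodMap measurable_id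
  have hΘ : Θ.map (Prod.map proj id) = ρ := by
    rw [← ρ.disintegrate ρ.condKernel, hfst]
    ext s hs
    rw [Measure.map_apply hprojid hs, Measure.compProd_apply (hprojid hs),
      Measure.compProd_apply hs,
      lintegral_map (Kernel.measurable_kernel_prodMk_left hs) hproj]
    rfl
  obtain ⟨Φ, hΦ⟩ := exists_isParametrization Θ
  have hjoint : lebUnit.map (fun t => (proj (Φ t).1, (Φ t).2)) = ρ := by
    rw [← hΘ, ← hΦ.map_eq, Measure.map_map hprojid hΦ.measurable]
    rfl
  refine ⟨fun t => (Φ t).1, fun t => (Φ t).2, ⟨hΦ.measurable.fst, ?_⟩,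
    ⟨hΦ.measurable.snd, ?_⟩, hjoint⟩
  · have hΘfst : Θ.fst = μ := Measure.fst_compProd μ κ
    rw [← hΘfst, Measure.fst, ← hΦ.map_eq, Measure.map_map measurable_fst hΦ.measurable]
    rfl
  · have hφ : Measurable (fun t => proj (Φ t).1) := hproj.comp hΦ.measurable.fst
    rw [← hsnd, ← hjoint, Measure.snd_map_prodMk hφ]

/-! ### The Ky Fan pseudo-metric -/

section KyFan

variable {Ω : Type*} [MeasurableSpace Ω] {ν : Measure Ω}

theorem meDist_comm (f g : Ω → ℝ) : meDist ν f g = meDist ν g f := by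
  simp only [meDist, abs_sub_comm]

theorem meDist_le {f g : Ω → ℝ} {r : ℝ} (hr : 0 < r)
    (h : ν {x | r < |f x - g x|} ≤ ENNReal.ofReal r) : meDist ν f g ≤ r :=
  csInf_le ⟨0, fun _ hs => hs.1.le⟩ ⟨hr, h⟩

theorem meDist_le_one [IsProbabilityMeasure ν] (f g : Ω → ℝ) : meDist ν f g ≤ 1 :=
  meDist_le one_pos (by simpa using prob_le_one)

/-- The triangle inequality for `meDist`, in the form in which the second distance is given by a
tail bound. -/
theorem meDist_lt_add [IsProbabilityMeasure ν] {f g h : Ω → ℝ} {r δ : ℝ}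
    (hfg : meDist ν f g < r) (hδ : 0 < δ)
    (hgh : ν {x | δ < |g x - h x|} ≤ ENNReal.ofReal δ) : meDist ν f h < r + δ := by
  obtain ⟨s, ⟨hs, hfg⟩, hsr⟩ := exists_lt_of_csInf_lt
    (by exact ⟨1, one_pos, by simpa using prob_le_one⟩) hfg
  refine (meDist_le (add_pos hs hδ) ?_).trans_lt (add_lt_add_left hsr δ)
  calc ν {x | s + δ < |f x - h x|}
      ≤ ν ({x | s < |f x - g x|} ∪ {x | δ < |g x - h x|}) := by
        refine measure_mono fun x hx => ?_
        by_contra! hcon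
        simp only [mem_union, mem_ofPred_eq, not_or, not_lt] at hcon hx
        linarith [abs_sub_le (f x) (g x) (h x), hcon.1, hcon.2]
    _ ≤ ENNReal.ofReal (s + δ) := by
        rw [ENNReal.ofReal_add hs.le hδ.le]
        exact (measure_union_le _ _).trans (add_le_add hfg hgh)

/-- The Ky Fan distance of functions of two random variables depends only on their joint law. -/
theorem meDist_comp_eq_of_map_prodMk_eq {A B : Type*} [MeasurableSpace A] [MeasurableSpace B]
    {a a' : Ω → A} {b b' : Ω → B} (ha : Measurable a) (ha' : Measurable a') (hb : Measurable b)
    (hb' : Measurable b') (h : ν.map (fun t => (a t, b t)) = ν.map (fun t => (a' t, b' t)))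
    {f : A → ℝ} {g : B → ℝ} (hf : Measurable f) (hg : Measurable g) :
    meDist ν (f ∘ a) (g ∘ b) = meDist ν (f ∘ a') (g ∘ b') := by
  have htail (r : ℝ) : ν {x | r < |(f ∘ a) x - (g ∘ b) x|} =
      ν {x | r < |(f ∘ a') x - (g ∘ b') x|} := by
    have hS : MeasurableSet {z : A × B | r < |f z.1 - g z.2|} :=
      measurableSet_lt measurable_const
        ((hf.comp measurable_fst).sub (hg.comp measurable_snd)).abs
    have heq := congrArg (fun ξ => ξ {z : A × B | r < |f z.1 - g z.2|}) h
    simp only [Measure.map_apply (ha.prodMk hb) hS, Measure.map_apply (ha'.prodMk hb') hS] at heq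
    exact heq
  simp only [meDist, htail]

end KyFan

/-! ### The observable distance -/

theorem hausdorffDistOf_nonneg {α : Type*} (d : α → α → ℝ) (A B : Set α) :
    0 ≤ hausdorffDistOf d A B :=
  Real.sInf_nonneg fun _ hr => hr.1.le

theorem hausdorffDistOf_le {α : Type*} {d : α → α → ℝ} {A B : Set α} {r : ℝ} (hr : 0 < r)
    (hB : ∀ b ∈ B, ∃ a ∈ A, d a b < r) (hA : ∀ a ∈ A, ∃ b ∈ B, d b a < r) :
    hausdorffDistOf d A B ≤ r :=
  csInf_le ⟨0, fun _ hs => hs.1.le⟩ ⟨hr, hB, hA⟩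

theorem nonempty_lipOneComp {X : Type*} [MetricSpace X] (φ : UnitIco → X) :
    (lipOneComp φ).Nonempty :=
  ⟨_, fun _ => 0, LipschitzWith.const' 0, rfl⟩

/-- The Ky Fan distance is at most `1`, so the infimum defining the Hausdorff distance of two sets
of observables is never taken over the empty set. -/
theorem exists_lt_of_hausdorffDistOf_lipOneComp_lt {X Y : Type*} [MetricSpace X] [MetricSpace Y]
    {φ : UnitIco → X} {ψ : UnitIco → Y} {r : ℝ}
    (h : hausdorffDistOf (meDist lebUnit) (lipOneComp φ) (lipOneComp ψ) < r) :
    ∃ s < r, 0 < s ∧ (∀ b ∈ lipOneComp ψ, ∃ a ∈ lipOneComp φ, meDist lebUnit a b < s) ∧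
      (∀ a ∈ lipOneComp φ, ∃ b ∈ lipOneComp ψ, meDist lebUnit b a < s) := by
  obtain ⟨a₀, ha₀⟩ := nonempty_lipOneComp φ
  obtain ⟨b₀, hb₀⟩ := nonempty_lipOneComp ψ
  obtain ⟨s, hs, hsr⟩ := exists_lt_of_csInf_lt
    (by exact ⟨2, two_pos, fun b _ => ⟨a₀, ha₀, (meDist_le_one _ _).trans_lt one_lt_two⟩,
      fun a _ => ⟨b₀, hb₀, (meDist_le_one _ _).trans_lt one_lt_two⟩⟩) h
  exact ⟨s, hsr, hs⟩

theorem dConc_nonneg {X Y : Type*} [MetricSpace X] [MeasurableSpace X] [MetricSpace Y]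
    [MeasurableSpace Y] (μ : Measure X) (ν : Measure Y) : 0 ≤ dConc μ ν := by
  refine Real.sInf_nonneg ?_
  rintro _ ⟨φ, ψ, -, -, rfl⟩
  exact hausdorffDistOf_nonneg _ _ _

theorem dConc_le {X Y : Type*} [MetricSpace X] [MeasurableSpace X] [MetricSpace Y]
    [MeasurableSpace Y] {μ : Measure X} {ν : Measure Y} {φ : UnitIco → X} {ψ : UnitIco → Y}
    (hφ : IsParametrization μ φ) (hψ : IsParametrization ν ψ) :
    dConc μ ν ≤ hausdorffDistOf (meDist lebUnit) (lipOneComp φ) (lipOneComp ψ) := by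
  refine csInf_le ⟨0, ?_⟩ ⟨φ, ψ, hφ, hψ, rfl⟩
  rintro _ ⟨φ, ψ, -, -, rfl⟩
  exact hausdorffDistOf_nonneg _ _ _

/-! ### Projection onto an isometrically embedded subset -/

/-- A `1`-Lipschitz function is close in measure to its composition with a nearest-point
projection onto a set whose neighbourhood carries almost all of the measure. -/
theorem lebUnit_abs_sub_comp_projection_le {N M : Type*} [MetricSpace N] [MeasurableSpace N]
    [BorelSpace N] [MetricSpace M] [MeasurableSpace M] {μ : Measure N} {ι : M → N} {proj : N → M}
    (hproj : IsProjection ι proj) {δ : ℝ}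
    (hμ : μ (Metric.thickening δ (range ι))ᶜ ≤ ENNReal.ofReal δ) {φ : UnitIco → N}
    (hφ : IsParametrization μ φ) {f : N → ℝ} (hf : LipschitzWith 1 f) :
    lebUnit {t | δ < |f (φ t) - f (ι (proj (φ t)))|} ≤ ENNReal.ofReal δ := by
  refine le_trans ?_ hμ
  rw [← hφ.map_eq, Measure.map_apply hφ.measurable Metric.isOpen_thickening.measurableSet.compl]
  refine measure_mono fun t ht hmem => ?_
  have hinf : Metric.infDist (φ t) (range ι) < δ := by
    obtain ⟨z, hz, hdist⟩ := Metric.mem_thickening_iff.1 hmem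
    exact (Metric.infDist_le_dist_of_mem hz).trans_lt hdist
  have hlip := hf.dist_le_mul (φ t) (ι (proj (φ t)))
  rw [Real.dist_eq, hproj.dist_eq, NNReal.coe_one, one_mul] at hlip
  exact (ht.trans_le hlip).not_gt hinf

/-- If all but `δ` of the mass of `N` lies in the `δ`-neighbourhood of an isometrically embedded
`M`, then replacing `M`, with the projected measure, by `N` increases observable distances by at
most `δ`. -/
theorem dConc_le_dConc_map_add {N M X : Type*} [MetricSpace N] [MeasurableSpace N] [BorelSpace N]
    [StandardBorelSpace N] [MetricSpace M] [MeasurableSpace M] [BorelSpace M]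
    [MetricSpace X] [MeasurableSpace X] [BorelSpace X] [StandardBorelSpace X]
    (μ : Measure N) [IsProbabilityMeasure μ] (σ : Measure X) [IsProbabilityMeasure σ]
    {ι : M → N} (hι : Isometry ι) {proj : N → M} (hproj : IsProjection ι proj) {δ : ℝ}
    (hδ : 0 < δ) (hμ : μ (Metric.thickening δ (range ι))ᶜ ≤ ENNReal.ofReal δ) :
    dConc μ σ ≤ dConc (μ.map proj) σ + δ := by
  have : Nonempty N := nonempty_of_isProbabilityMeasure μ
  have : Nonempty M := ‹Nonempty N›.map proj
  have : Nonempty X := nonempty_of_isProbabilityMeasure σ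
  refine le_of_forall_gt_imp_ge_of_dense fun r hr => ?_
  rw [← lt_sub_iff_add_lt] at hr
  obtain ⟨φ₀, hφ₀⟩ := exists_isParametrization μ
  obtain ⟨ψ₀, hψ₀⟩ := exists_isParametrization σ
  have hφ₁ : IsParametrization (μ.map proj) (proj ∘ φ₀) :=
    ⟨hproj.measurable.comp hφ₀.measurable, by
      rw [← Measure.map_map hproj.measurable hφ₀.measurable, hφ₀.map_eq]⟩
  obtain ⟨_, ⟨φ', ψ, hφ', hψ, rfl⟩, hlt⟩ :=
    exists_lt_of_csInf_lt (by exact ⟨_, proj ∘ φ₀, ψ₀, hφ₁, hψ₀, rfl⟩) hr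
  obtain ⟨s, hsr, hs, hX, hM⟩ := exists_lt_of_hausdorffDistOf_lipOneComp_lt hlt
  obtain ⟨φ, ψ', hφ, hψ', hjoint⟩ := exists_isParametrization_lift hproj.measurable hφ' hψ
  have hlaw {f : M → ℝ} {g : X → ℝ} (hf : LipschitzWith 1 f) (hg : LipschitzWith 1 g) :
      meDist lebUnit (g ∘ ψ') (f ∘ (proj ∘ φ)) = meDist lebUnit (g ∘ ψ) (f ∘ φ') := by
    rw [meDist_comm, meDist_comm (g ∘ ψ)]
    exact meDist_comp_eq_of_map_prodMk_eq (hproj.measurable.comp hφ.measurable) hφ'.measurable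
      hψ'.measurable hψ.measurable hjoint hf.continuous.measurable hg.continuous.measurable
  have hclose {f : N → ℝ} {g : X → ℝ} (hf : LipschitzWith 1 f) (hg : LipschitzWith 1 g)
      (h : meDist lebUnit (g ∘ ψ) ((f ∘ ι) ∘ φ') < s) :
      meDist lebUnit (g ∘ ψ') (f ∘ φ) < s + δ := by
    have hfι : LipschitzWith 1 (f ∘ ι) := by simpa using hf.comp hι.lipschitz
    rw [← hlaw hfι hg] at h
    refine meDist_lt_add h hδ ?_
    simpa only [Function.comp_apply, abs_sub_comm] using
      lebUnit_abs_sub_comp_projection_le hproj hμ hφ hf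
  refine (dConc_le hφ hψ').trans ((hausdorffDistOf_le (add_pos hs hδ) ?_ ?_).trans
    (by linarith : s + δ ≤ r))
  · rintro _ ⟨g, hg, rfl⟩
    obtain ⟨_, ⟨f, hf, rfl⟩, hfg⟩ := hX _ ⟨g, hg, rfl⟩
    rw [meDist_comm] at hfg
    -- McShane's theorem extends `f`, transported to the range of `ι`, to all of `N`.
    obtain ⟨F, hF, hFι⟩ : ∃ F : N → ℝ, LipschitzWith 1 F ∧ F ∘ ι = f := by
      have hleft : Function.LeftInverse (Function.invFun ι) ι :=
        Function.leftInverse_invFun hι.injective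
      have hlip : LipschitzOnWith 1 (f ∘ Function.invFun ι) (range ι) := by
        rintro _ ⟨x, rfl⟩ _ ⟨y, rfl⟩
        simpa only [Function.comp_apply, hleft x, hleft y, hι.edist_eq] using hf x y
      obtain ⟨F, hF, heq⟩ := hlip.extend_real
      exact ⟨F, hF, funext fun x => by
        simpa [hleft x] using (heq (mem_range_self x)).symm⟩
    refine ⟨_, ⟨F, hF, rfl⟩, ?_⟩
    rw [meDist_comm]
    exact hclose hF hg (by rwa [hFι])
  · rintro _ ⟨f, hf, rfl⟩
    have hfι : LipschitzWith 1 (f ∘ ι) := by simpa using hf.comp hι.lipschitz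
    obtain ⟨_, ⟨g, hg, rfl⟩, hfg⟩ := hM _ ⟨f ∘ ι, hfι, rfl⟩
    exact ⟨_, ⟨g, hg, rfl⟩, hclose hf hg hfg⟩

/-! ### Concentration loci -/

theorem mainTheorem1
    -- the ambient manifolds `N n`
    {q : ℕ → ℕ} {N : ℕ → Type*}
    [∀ n, MetricSpace (N n)] [∀ n, ChartedSpace (EuclideanSpace ℝ (Fin (q n))) (N n)]
    [∀ n, IsManifold (𝓡 (q n)) ∞ (N n)]
    [∀ n, Bundle.RiemannianBundle (fun x : N n => TangentSpace (𝓡 (q n)) x)]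
    [∀ n, IsContMDiffRiemannianBundle (𝓡 (q n)) ∞ (EuclideanSpace ℝ (Fin (q n)))
      (fun x : N n => TangentSpace (𝓡 (q n)) x)]
    [∀ n, IsRiemannianManifold (𝓡 (q n)) (N n)]
    [∀ n, CompleteSpace (N n)] [∀ n, TopologicalSpace.SeparableSpace (N n)]
    [∀ n, MeasurableSpace (N n)] [∀ n, BorelSpace (N n)]
    (μ : ∀ n, Measure (N n)) [∀ n, IsProbabilityMeasure (μ n)]
    -- the submanifolds `M n`, with inclusions `ι n`
    {p : ℕ → ℕ} {M : ℕ → Type*}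
    [∀ n, MetricSpace (M n)] [∀ n, ChartedSpace (EuclideanSpace ℝ (Fin (p n))) (M n)]
    [∀ n, IsManifold (𝓡 (p n)) ∞ (M n)]
    [∀ n, Bundle.RiemannianBundle (fun x : M n => TangentSpace (𝓡 (p n)) x)]
    [∀ n, IsContMDiffRiemannianBundle (𝓡 (p n)) ∞ (EuclideanSpace ℝ (Fin (p n)))
      (fun x : M n => TangentSpace (𝓡 (p n)) x)]
    [∀ n, IsRiemannianManifold (𝓡 (p n)) (M n)]
    [∀ n, MeasurableSpace (M n)] [∀ n, BorelSpace (M n)]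
    (ι : ∀ n, M n → N n)
    (hsub : ∀ n, IsRiemannianEmbedding (p := p n) (q := q n) (ι n))
    (hgeod : ∀ n, IsTotallyGeodesic (ι n))
    (hdist : ∀ n, ∀ x y : M n, dist (ι n x) (ι n y) = dist x y)
    -- the concentration locus and the projections
    (ε : ℕ → ℝ) (hloc : IsConcentrationLocus μ (fun n => range (ι n)) ε)
    (proj : ∀ n, N n → M n) (hproj : ∀ n, IsProjection (ι n) (proj n))
    -- the limit mm-space
    {X : Type*} [MetricSpace X] [CompleteSpace X] [TopologicalSpace.SeparableSpace X]
    [MeasurableSpace X] [BorelSpace X] (σ : Measure X) [IsProbabilityMeasure σ]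
    (hconc : ConcentratesTo (fun n => (μ n).map (proj n)) σ) :
    ConcentratesTo μ σ := by
  have hstd (n : ℕ) : StandardBorelSpace (N n) := by
    have : SecondCountableTopology (N n) := UniformSpace.secondCountable_of_separable (N n)
    infer_instance
  have : StandardBorelSpace X := by
    have : SecondCountableTopology X := UniformSpace.secondCountable_of_separable X
    infer_instance
  let m : ℕ → ENNReal := fun n => μ n (Metric.thickening (ε n) (range (ι n)))ᶜ
  let δ : ℕ → ℝ := fun n => max (ε n) (m n).toReal
  have hδ : Tendsto δ atTop (𝓝 0) := by
    have hm : Tendsto (fun n => (m n).toReal) atTop (𝓝 0) :=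
      (ENNReal.tendsto_toReal_zero_iff fun n => measure_ne_top _ _).2 hloc.tendsto_compl
    simpa using hloc.radius_tendsto.max hm
  have hle (n : ℕ) : dConc (μ n) σ ≤ dConc ((μ n).map (proj n)) σ + δ n := by
    refine dConc_le_dConc_map_add (μ n) σ (Isometry.of_dist_eq (hdist n)) (hproj n)
      (lt_max_of_lt_left (hloc.radius_pos n)) ?_
    calc μ n (Metric.thickening (δ n) (range (ι n)))ᶜ ≤ m n :=
          measure_mono (compl_subset_compl.2 (Metric.thickening_mono (le_max_left _ _) _))
      _ = ENNReal.ofReal (m n).toReal := (ENNReal.ofReal_toReal (measure_ne_top _ _)).symm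
      _ ≤ ENNReal.ofReal (δ n) := ENNReal.ofReal_le_ofReal (le_max_right _ _)
  refine squeeze_zero (fun n => dConc_nonneg _ _) hle ?_
  simpa using Tendsto.add hconc hδ
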